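/- Let $H\neq\{0\}$ be a complex Hilbert space and let $\mathbb{B}(H)_+$ be the cone of positive bounded operators on $H$ with the usual order. A binary operation $\sigma:\mathbb{B}(H)_+\times\mathbb{B}(H)_+\to\mathbb{B}(H)_+$ is called an operator mean if (i) $A\le C$ and $B\le D$ imply $A\sigma B\le C\sigma D$; (ii) $C^*(A\sigma B)C\le (C^*AC)\sigma(C^*BC)$ for every bounded operator $C$; (iii) $A_n\downarrow A$ and $B_n\downarrow B$ imply $A_n\sigma B_n\downarrow A\sigma B$, where $A_n\downarrow A$ means that $A_1\ge A_2\ge\cdots$ and $A_n\to A$ in the strong operator topology; (iv) $I\sigma I=I$. Its representing function $f$ on $[0,\infty)$ is determined by $I\sigma(xI)=f(x)I$ for $x\ge 0$. Theorem. Let $\sigma,\tau,\rho$ be operator means on $\mathbb{B}(H)_+$ with representing functions $f,g,h$, respectively. Then $g(t)>0$ for all $t>0$. Moreover, $\sigma$ is invariant with respect to $\tau,\rho$, i.e. $$A\sigma B=(A\tau B)\,\sigma\,(A\rho B)\qquad\text{for all }A,B\in\mathbb{B}(H)_+,$$ if and only if $$f(t)=g(t)\,f\bigl(g(t)^{-1}h(t)\bigr)\qquad\text{for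 all }t\ge 0,$$ where, if $g(0)=0$, the right-hand side at $t=0$ is understood as its limit as $t\downarrow 0$ (i.e. the equation at $t=0$ then says that this limit exists and equals $f(0)$). -/

import Mathlib

open Filter Topology

/-- The cone `𝔹(H)₊` of positive bounded operators on a complex Hilbert space `H`
(with the Loewner order inherited from `H →L[ℂ] H`). -/
abbrev PosOp (H : Type*) [NormedAddCommGroup H] [InnerProductSpace ℂ H] [CompleteSpace H] :=
  {A : H →L[ℂ] H // 0 ≤ A}

namespace PosOp

variable {H : Type*} [NormedAddCommGroup H] [InnerProductSpace ℂ H] [CompleteSpace H]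

/-- The congruence `C⋆ A C` of a positive operator `A` by a bounded operator `C`. -/
noncomputable def conj (C : H →L[ℂ] H) (A : PosOp H) : PosOp H :=
  ⟨star C * (A : H →L[ℂ] H) * C, star_left_conjugate_nonneg A.2 C⟩

/-- The positive operator `x I`, for a real number `x ≥ 0`. -/
noncomputable def scalar (x : ℝ) (hx : 0 ≤ x) : PosOp H :=
  ⟨x • (1 : H →L[ℂ] H), smul_nonneg hx zero_le_one⟩

/-- The identity `I` as a positive operator. -/
def one : PosOp H := ⟨1, zero_le_one⟩

/-- `Aₙ ↓ A`: the sequence is decreasing and converges to `A` in the strong operator topology. -/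
def DecreasesTo (u : ℕ → PosOp H) (A : PosOp H) : Prop :=
  Antitone u ∧
    ∀ v : H, Tendsto (fun n => (u n : H →L[ℂ] H) v) atTop (𝓝 ((A : H →L[ℂ] H) v))

end PosOp

/-- A Kubo–Ando operator mean on `𝔹(H)₊`: a binary operation on the cone of positive operators
satisfying monotonicity, the transformer inequality, continuity from above and normalization. -/
structure IsOperatorMean {H : Type*} [NormedAddCommGroup H] [InnerProductSpace ℂ H]
    [CompleteSpace H] (σ : PosOp H → PosOp H → PosOp H) : Prop where
  mono : ∀ A B C D : PosOp H, A ≤ C → B ≤ D → σ A B ≤ σ C D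
  transformer : ∀ (C : H →L[ℂ] H) (A B : PosOp H),
    PosOp.conj C (σ A B) ≤ σ (PosOp.conj C A) (PosOp.conj C B)
  continuous_above : ∀ (u v : ℕ → PosOp H) (A B : PosOp H),
    PosOp.DecreasesTo u A → PosOp.DecreasesTo v B →
      PosOp.DecreasesTo (fun n => σ (u n) (v n)) (σ A B)
  normalized : σ PosOp.one PosOp.one = PosOp.one

/-- `f` (on `[0, ∞)`) is the representing function of `σ`: `I σ (x I) = f(x) I` for `x ≥ 0`.
Values of `f` at negative numbers are irrelevant. -/
def IsRepresentingFunction {H : Type*} [NormedAddCommGroup H] [InnerProductSpace ℂ H]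
    [CompleteSpace H] (σ : PosOp H → PosOp H → PosOp H) (f : ℝ → ℝ) : Prop :=
  ∀ (x : ℝ) (hx : 0 ≤ x),
    (σ PosOp.one (PosOp.scalar x hx) : H →L[ℂ] H) = f x • (1 : H →L[ℂ] H)

/-- `σ` is invariant with respect to `τ` and `ρ`: `A σ B = (A τ B) σ (A ρ B)` for all
positive operators `A` and `B`. -/
def IsInvariantMean {H : Type*} [NormedAddCommGroup H] [InnerProductSpace ℂ H]
    [CompleteSpace H] (σ τ ρ : PosOp H → PosOp H → PosOp H) : Prop :=
  ∀ A B : PosOp H, σ A B = σ (τ A B) (ρ A B)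

/-! ### Joint functional calculus of commuting self-adjoint elements. -/

section CStarAlgebra

/-! Congruence by an invertible operator commutes with every mean, so for invertible arguments it
suffices to treat `A = I` and `B = Z`, where `I σ Z = f(Z)` (`coe_eq_cfc`). With `S = g(Z)^{1/2}`
one has `I τ Z = S* I S` and `I ρ Z = S* (h/g)(Z) S`, so the right-hand side of the invariance
identity is `(g · f(h/g))(Z)`. Adding `(n+1)⁻¹ I` and using continuity from above covers all
positive operators. Conversely, evaluate at `B = tI`; if `g 0 = 0`, use right-continuity of `f` at
`0`.

No spectral projections are needed for `I σ X = f(X)`: at each `x` in the spectrum, monotonicity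
gives `f(x) min(1, X/x) ≤ I σ X ≤ f(x) max(1, X/x)`, with both bounds equal to `f(x)` at `x`. As `I
σ X` commutes with `X`, these become scalar inequalities. -/

open ComplexOrder in
/-- If commuting self-adjoint elements `X`, `Y` satisfy, for every point `x` of the spectrum of `X`,
bounds `l(X) ≤ Y ≤ u(X)` that are tight at `x`, then `Y` is a function of `X`. -/
theorem eq_cfc_of_tight_bounds {A : Type*} [CStarAlgebra A] [PartialOrder A] [StarOrderedRing A]
    {X Y : A} (hX : IsSelfAdjoint X) (hY : IsSelfAdjoint Y) (hXY : Commute X Y) {f : ℝ → ℝ}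
    (hf : ContinuousOn f (spectrum ℝ X))
    (hl : ∀ x ∈ spectrum ℝ X, ∃ l : ℝ → ℝ, ContinuousOn l (spectrum ℝ X) ∧
      cfc l X ≤ Y ∧ l x = f x)
    (hu : ∀ x ∈ spectrum ℝ X, ∃ u : ℝ → ℝ, ContinuousOn u (spectrum ℝ X) ∧
      Y ≤ cfc u X ∧ u x = f x) :
    Y = cfc f X := by
  -- `Z = X + iY` is normal, so its spectrum serves as the joint spectrum of `X` and `Y`.
  obtain ⟨Z, hre, him⟩ : ∃ Z : A, (realPart Z : A) = X ∧ (imaginaryPart Z : A) = Y :=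
    ⟨X + Complex.I • Y, by simp [hX.coe_realPart, hY.imaginaryPart],
      by simp [hX.imaginaryPart, hY.coe_realPart]⟩
  have hZ : IsStarNormal Z := by
    rw [isStarNormal_iff_commute_realPart_imaginaryPart, hre, him]
    exact hXY
  have hcont : ∀ k : ℝ → ℝ, ContinuousOn k (spectrum ℝ X) →
      ContinuousOn (fun z : ℂ => (k z.re : ℂ)) (spectrum ℂ Z) := by
    intro k hk
    rw [← hre, spectrum_realPart' Z] at hk
    exact Complex.continuous_ofReal.comp_continuousOn
      (hk.comp Complex.continuous_re.continuousOn (Set.mapsTo_image _ _))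
  have hcomp : ∀ k : ℝ → ℝ, ContinuousOn k (spectrum ℝ X) →
      cfc k X = cfc (fun z : ℂ => (k z.re : ℂ)) Z := by
    intro k hk
    subst hre
    exact (cfc_comp_re k Z hk).symm
  have hYZ : Y = cfc (fun z : ℂ => (z.im : ℂ)) Z := by rw [cfc_im_id Z, him]
  have him_cont : ContinuousOn (fun z : ℂ => (z.im : ℂ)) (spectrum ℂ Z) := by fun_prop
  rw [hcomp f hf, hYZ]
  refine cfc_congr fun z hz => ?_
  have hzX : z.re ∈ spectrum ℝ X := by
    rw [← hre, spectrum_realPart' Z]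
    exact ⟨z, hz, rfl⟩
  obtain ⟨l, hlc, hlY, hlz⟩ := hl _ hzX
  obtain ⟨u, huc, huY, huz⟩ := hu _ hzX
  rw [hcomp l hlc, hYZ, cfc_le_iff _ _ Z (hcont l hlc) him_cont] at hlY
  rw [hcomp u huc, hYZ, cfc_le_iff _ _ Z him_cont (hcont u huc)] at huY
  have h1 := hlY z hz
  have h2 := huY z hz
  simp only [Complex.real_le_real] at h1 h2
  rw [hlz] at h1
  rw [huz] at h2
  simpa using le_antisymm h2 h1

/-- An element commuting with all unitaries that commute with a self-adjoint `X` commutes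
with `X`. -/
theorem commute_of_forall_unitary_commute {A : Type*} [CStarAlgebra A] [PartialOrder A]
    [StarOrderedRing A] {X Y : A} (hX : IsSelfAdjoint X)
    (h : ∀ U : unitary A, Commute (U : A) X → Commute (U : A) Y) : Commute X Y := by
  -- Scaling to norm at most one makes `r • X` the real part of a unitary; the `+ 1` covers `X = 0`.
  set r : ℝ := (‖X‖ + 1)⁻¹ with hr
  have hr0 : 0 < r := by positivity
  have hsa : IsSelfAdjoint (r • X) := (IsSelfAdjoint.all r).smul hX
  have hnorm : ‖(⟨r • X, hsa⟩ : selfAdjoint A)‖ ≤ 1 := by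
    change ‖r • X‖ ≤ 1
    rw [norm_smul, Real.norm_of_nonneg hr0.le, hr, inv_mul_le_iff₀ (by positivity)]
    linarith
  set U := selfAdjoint.unitarySelfAddISMul ⟨r • X, hsa⟩ hnorm
  have hUs : ((star U : unitary A) : A) = r • X - Complex.I • CFC.sqrt (1 - (r • X) ^ 2) :=
    selfAdjoint.star_coe_unitarySelfAddISMul _ hnorm
  have hUc : (U : A) = r • X + Complex.I • CFC.sqrt (1 - (r • X) ^ 2) := rfl
  have hsq : Commute (CFC.sqrt (1 - (r • X) ^ 2)) X := by
    rw [CFC.sqrt_eq_cfc]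
    refine Commute.cfc_nnreal ?_ _
    exact (Commute.one_left X).sub_left (((Commute.refl X).smul_left r).pow_left 2)
  have hUX : Commute (U : A) X :=
    ((Commute.refl X).smul_left r).add_left (hsq.smul_left Complex.I)
  have hUsX : Commute ((star U : unitary A) : A) X := by
    rw [hUs]
    exact ((Commute.refl X).smul_left r).sub_left (hsq.smul_left Complex.I)
  have hsum : (U : A) + ((star U : unitary A) : A) = (2 * r) • X := by
    rw [hUs, hUc, two_mul, add_smul]
    abel
  have hXs : X = (2 * r)⁻¹ • ((U : A) + ((star U : unitary A) : A)) := by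
    rw [hsum, smul_smul, inv_mul_cancel₀ (by positivity), one_smul]
  rw [hXs]
  exact ((h U hUX).add_left (h (star U) hUsX)).smul_left _

end CStarAlgebra

namespace PosOp

variable {H : Type*} [NormedAddCommGroup H] [InnerProductSpace ℂ H] [CompleteSpace H]

theorem conj_mono (C : H →L[ℂ] H) {A B : PosOp H} (h : A ≤ B) : conj C A ≤ conj C B :=
  star_left_conjugate_le_conjugate (show A.1 ≤ B.1 from h) C

theorem conj_conj (C D : H →L[ℂ] H) (A : PosOp H) : conj D (conj C A) = conj (C * D) A :=
  Subtype.ext (by simp [conj, mul_assoc])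

theorem conj_one_left (A : PosOp H) : conj 1 A = A :=
  Subtype.ext (by simp [conj])

theorem DecreasesTo.limit_unique {u : ℕ → PosOp H} {A B : PosOp H}
    (hA : DecreasesTo u A) (hB : DecreasesTo u B) : A = B :=
  Subtype.ext (ContinuousLinearMap.ext fun v => tendsto_nhds_unique (hA.2 v) (hB.2 v))

/-- The perturbation `A + (n + 1)⁻¹ I`. -/
noncomputable def addInv (A : PosOp H) (n : ℕ) : PosOp H :=
  ⟨A.1 + ((n : ℝ) + 1)⁻¹ • (1 : H →L[ℂ] H),
    add_nonneg A.2 (smul_nonneg (by positivity) zero_le_one)⟩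

theorem decreasesTo_addInv (A : PosOp H) : DecreasesTo (addInv A) A := by
  refine ⟨fun m n hmn => ?_, fun v => ?_⟩
  · refine add_le_add_right (a := A.1) (smul_le_smul_of_nonneg_right ?_ zero_le_one)
    gcongr
  · have h := (tendsto_one_div_add_atTop_nhds_zero_nat (𝕜 := ℝ)).smul_const v
    have h2 := h.const_add (A.1 v)
    simpa [addInv, one_div] using h2

theorem isStrictlyPositive_smul_one {x : ℝ} (hx : 0 < x) :
    IsStrictlyPositive (x • (1 : H →L[ℂ] H)) :=
  IsUnit.isStrictlyPositive ((isUnit_one).smul (Units.mk0 x hx.ne')) (smul_nonneg hx.le zero_le_one)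

theorem isStrictlyPositive_addInv (A : PosOp H) (n : ℕ) : IsStrictlyPositive (addInv A n).1 :=
  IsStrictlyPositive.nonneg_add A.2 (isStrictlyPositive_smul_one (by positivity))

/-- A positive invertible operator is congruent to the identity. -/
theorem exists_conj_one_eq (A : PosOp H) (hA : IsUnit A.1) :
    ∃ S : H →L[ℂ] H, IsUnit S ∧ conj S one = A := by
  refine ⟨CFC.sqrt A.1, (CFC.isUnit_sqrt_iff A.1 A.2).2 hA, Subtype.ext ?_⟩
  simp [conj, one, (CFC.sqrt_nonneg A.1).isSelfAdjoint.star_eq, CFC.sqrt_mul_sqrt_self A.1 A.2]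

theorem le_of_smul_one_le [Nontrivial H] {a b : ℝ}
    (h : a • (1 : H →L[ℂ] H) ≤ b • (1 : H →L[ℂ] H)) : a ≤ b := by
  rw [← Algebra.algebraMap_eq_smul_one, ← Algebra.algebraMap_eq_smul_one] at h
  exact (algebraMap_le_algebraMap).1 h

end PosOp

/-! ### Congruence invariance of means. -/

namespace IsOperatorMean

open PosOp

variable {H : Type*} [NormedAddCommGroup H] [InnerProductSpace ℂ H] [CompleteSpace H]
  {σ : PosOp H → PosOp H → PosOp H}

/-- The transformer inequality for `C⁻¹`, conjugated back by `C`, is the reverse inequality. -/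
theorem conj_eq (hσ : IsOperatorMean σ) {C : H →L[ℂ] H} (hC : IsUnit C) (A B : PosOp H) :
    conj C (σ A B) = σ (conj C A) (conj C B) := by
  refine le_antisymm (hσ.transformer C A B) ?_
  obtain ⟨u, rfl⟩ := hC
  have h := conj_mono (u : H →L[ℂ] H)
    (hσ.transformer (↑u⁻¹ : H →L[ℂ] H) (conj (u : H →L[ℂ] H) A) (conj (u : H →L[ℂ] H) B))
  simpa only [conj_conj, Units.mul_inv, Units.inv_mul, conj_one_left] using h

theorem coe_eq_smul (hσ : IsOperatorMean σ) {f : ℝ → ℝ} (hf : IsRepresentingFunction σ f)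
    {D E : PosOp H} (hD : IsUnit D.1) {y : ℝ} (hy : 0 ≤ y) (hE : E.1 = y • D.1) :
    (σ D E).1 = f y • D.1 := by
  obtain ⟨S, hS, rfl⟩ := exists_conj_one_eq D hD
  obtain rfl : E = conj S (scalar y hy) := Subtype.ext (by simp [hE, conj, scalar, one])
  rw [← hσ.conj_eq hS]
  change star S * (σ one (scalar y hy)).1 * S = f y • (star S * 1 * S)
  rw [hf y hy, mul_smul_comm, smul_mul_assoc]

end IsOperatorMean

/-! ### Representing functions and functional calculus. -/

namespace IsRepresentingFunction

open PosOp

variable {H : Type*} [NormedAddCommGroup H] [InnerProductSpace ℂ H] [CompleteSpace H]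
  {σ : PosOp H → PosOp H → PosOp H} {f : ℝ → ℝ}

section Nontrivial

variable [Nontrivial H]

theorem nonneg (hf : IsRepresentingFunction σ f) {x : ℝ} (hx : 0 ≤ x) : 0 ≤ f x := by
  apply le_of_smul_one_le (H := H)
  rw [zero_smul, ← hf x hx]
  exact (σ _ _).2

theorem map_one (hf : IsRepresentingFunction σ f) (hσ : IsOperatorMean σ) : f 1 = 1 := by
  have h : (scalar 1 zero_le_one : PosOp H) = one := Subtype.ext (by simp [scalar, one])
  have h1 := hf 1 zero_le_one
  rw [h, hσ.normalized] at h1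
  have h2 : (1 : ℝ) • (1 : H →L[ℂ] H) = f 1 • (1 : H →L[ℂ] H) := by simpa [one] using h1
  exact le_antisymm (le_of_smul_one_le h2.ge) (le_of_smul_one_le h2.le)

theorem mono (hf : IsRepresentingFunction σ f) (hσ : IsOperatorMean σ) {x y : ℝ} (hx : 0 ≤ x)
    (hxy : x ≤ y) : f x ≤ f y := by
  apply le_of_smul_one_le (H := H)
  rw [← hf x hx, ← hf y (hx.trans hxy)]
  exact hσ.mono _ _ _ _ le_rfl
    (show x • (1 : H →L[ℂ] H) ≤ y • 1 from smul_le_smul_of_nonneg_right hxy zero_le_one)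

/-- Says that `f(x)/x` is decreasing: `(x/y)I σ xI ≤ I σ xI`, and the left side is `(x/y) f(y) I` by
homogeneity. -/
theorem mul_le_mul (hf : IsRepresentingFunction σ f) (hσ : IsOperatorMean σ) {x y : ℝ}
    (hx : 0 < x) (hxy : x ≤ y) : x * f y ≤ y * f x := by
  have hy : 0 < y := hx.trans_le hxy
  have hD : IsUnit (scalar (H := H) (x / y) (by positivity)).1 :=
    (isStrictlyPositive_smul_one (by positivity)).isUnit
  have h1 : (scalar (H := H) x hx.le).1 = y • (scalar (H := H) (x / y) (by positivity)).1 := by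
    simp only [scalar, smul_smul]
    field_simp
  have h2 := hσ.coe_eq_smul hf hD hy.le h1
  have h3 : σ (scalar (x / y) (by positivity)) (scalar x hx.le) ≤ σ one (scalar x hx.le) := by
    refine hσ.mono _ _ _ _ ?_ le_rfl
    change (x / y) • (1 : H →L[ℂ] H) ≤ 1
    calc (x / y) • (1 : H →L[ℂ] H) ≤ (1 : ℝ) • (1 : H →L[ℂ] H) :=
          smul_le_smul_of_nonneg_right ((div_le_one hy).2 hxy) zero_le_one
      _ = 1 := one_smul _ _
  have h4 : (f y * (x / y)) • (1 : H →L[ℂ] H) ≤ f x • (1 : H →L[ℂ] H) := by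
    rw [← hf x hx.le, ← smul_smul]
    exact h2.symm.le.trans h3
  have h5 := le_of_smul_one_le h4
  rw [mul_div_assoc', div_le_iff₀ hy] at h5
  linarith

theorem pos (hf : IsRepresentingFunction σ f) (hσ : IsOperatorMean σ) {x : ℝ} (hx : 0 < x) :
    0 < f x := by
  rcases le_total x 1 with h | h
  · have := hf.mul_le_mul hσ hx h
    rw [hf.map_one hσ] at this
    linarith
  · have := hf.mono hσ zero_le_one h
    rw [hf.map_one hσ] at this
    linarith

/-- With `le_mul_max`, this squeezes `f` near `x` by bounds tight at `y = x`, which gives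
continuity. -/
theorem mul_min_le (hf : IsRepresentingFunction σ f) (hσ : IsOperatorMean σ) {x y : ℝ}
    (hx : 0 < x) (hy : 0 < y) : f x * min 1 (y / x) ≤ f y := by
  rcases le_total x y with h | h
  · rw [min_eq_left ((one_le_div hx).2 h), mul_one]
    exact hf.mono hσ hx.le h
  · rw [min_eq_right ((div_le_one hx).2 h), mul_div_assoc', div_le_iff₀ hx]
    linarith [hf.mul_le_mul hσ hy h]

theorem le_mul_max (hf : IsRepresentingFunction σ f) (hσ : IsOperatorMean σ) {x y : ℝ}
    (hx : 0 < x) (hy : 0 < y) : f y ≤ f x * max 1 (y / x) := by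
  rcases le_total x y with h | h
  · rw [max_eq_right ((one_le_div hx).2 h), mul_div_assoc', le_div_iff₀ hx]
    linarith [hf.mul_le_mul hσ hx h]
  · rw [max_eq_left ((div_le_one hx).2 h), mul_one]
    exact hf.mono hσ hy.le h

theorem continuousOn (hf : IsRepresentingFunction σ f) (hσ : IsOperatorMean σ) :
    ContinuousOn f (Set.Ioi 0) := by
  intro x hx
  have hx : 0 < x := hx
  have hmin : Tendsto (fun y => f x * min 1 (y / x)) (𝓝[Set.Ioi 0] x) (𝓝 (f x)) := by
    have h : Continuous fun y => f x * min 1 (y / x) := by fun_prop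
    have h1 := (h.tendsto x).mono_left (nhdsWithin_le_nhds (s := Set.Ioi 0))
    simpa [hx.ne'] using h1
  have hmax : Tendsto (fun y => f x * max 1 (y / x)) (𝓝[Set.Ioi 0] x) (𝓝 (f x)) := by
    have h : Continuous fun y => f x * max 1 (y / x) := by fun_prop
    have h1 := (h.tendsto x).mono_left (nhdsWithin_le_nhds (s := Set.Ioi 0))
    simpa [hx.ne'] using h1
  refine tendsto_of_tendsto_of_tendsto_of_le_of_le' hmin hmax ?_ ?_
  · filter_upwards [self_mem_nhdsWithin] with y hy using hf.mul_min_le hσ hx hy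
  · filter_upwards [self_mem_nhdsWithin] with y hy using hf.le_mul_max hσ hx hy

theorem tendsto_zero (hf : IsRepresentingFunction σ f) (hσ : IsOperatorMean σ) :
    Tendsto f (𝓝[>] 0) (𝓝 (f 0)) := by
  have hconst : DecreasesTo (fun _ => (one : PosOp H)) one :=
    ⟨antitone_const, fun v => tendsto_const_nhds⟩
  have hlim := hσ.continuous_above _ _ _ _ hconst (decreasesTo_addInv (scalar (H := H) 0 le_rfl))
  obtain ⟨v, hv⟩ := exists_ne (0 : H)
  have hseq : Tendsto (fun n : ℕ => f ((n : ℝ) + 1)⁻¹) atTop (𝓝 (f 0)) := by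
    have h := (hlim.2 v).norm
    have hE : ∀ n : ℕ, addInv (scalar (H := H) 0 le_rfl) n
        = scalar (((n : ℝ) + 1)⁻¹) (by positivity) :=
      fun n => Subtype.ext (by simp [addInv, scalar])
    have hval : ∀ x (hx : 0 ≤ x), ‖(σ one (scalar x hx)).1 v‖ = f x * ‖v‖ := by
      intro x hx
      rw [hf x hx]
      simp [norm_smul, abs_of_nonneg (hf.nonneg hx)]
    simp only [hE, hval] at h
    have h2 := h.mul_const ‖v‖⁻¹
    simpa [mul_assoc, norm_ne_zero_iff.2 hv] using h2
  -- Monotonicity upgrades convergence along `(n+1)⁻¹` to the full right limit.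
  refine tendsto_order.2 ⟨fun a ha => ?_, fun b hb => ?_⟩
  · filter_upwards [self_mem_nhdsWithin] with x hx
    exact ha.trans_le (hf.mono hσ le_rfl (le_of_lt hx))
  · obtain ⟨n, hn⟩ := (hseq.eventually_lt_const hb).exists
    have hpos : (0 : ℝ) < ((n : ℝ) + 1)⁻¹ := by positivity
    filter_upwards [Ioo_mem_nhdsGT hpos] with x hx
    exact (hf.mono hσ hx.1.le hx.2.le).trans_lt hn

end Nontrivial

/-- Conjugation by a unitary commuting with `X` fixes `I` and `X`, hence also `I σ X`. -/
theorem commute_coe (hσ : IsOperatorMean σ) (X : PosOp H) : Commute X.1 (σ one X).1 := by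
  refine commute_of_forall_unitary_commute X.2.isSelfAdjoint fun U hU => ?_
  have key : ∀ T : H →L[ℂ] H, star (U : H →L[ℂ] H) * T * U = T ↔ Commute (U : H →L[ℂ] H) T := by
    intro T
    have h1 : star (U : H →L[ℂ] H) * U = 1 := Unitary.coe_star_mul_self U
    have h2 : (U : H →L[ℂ] H) * star (U : H →L[ℂ] H) = 1 := Unitary.coe_mul_star_self U
    constructor
    · intro h
      change (U : H →L[ℂ] H) * T = T * U
      conv_lhs => rw [← h]
      rw [← mul_assoc, ← mul_assoc, h2, one_mul]
    · intro h
      rw [mul_assoc, ← h.eq, ← mul_assoc, h1, one_mul]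
  have hunit : IsUnit (U : H →L[ℂ] H) := (Unitary.toUnits U).isUnit
  have h := hσ.conj_eq hunit one X
  have hone : conj (U : H →L[ℂ] H) one = one := Subtype.ext ((key 1).2 (Commute.one_right _))
  have hX : conj (U : H →L[ℂ] H) X = X := Subtype.ext ((key X.1).2 hU)
  rw [hone, hX] at h
  exact (key _).1 (congrArg Subtype.val h)

/-- `I σ X = f(X)` for positive invertible `X`. -/
theorem coe_eq_cfc [Nontrivial H] (hf : IsRepresentingFunction σ f) (hσ : IsOperatorMean σ)
    {X : PosOp H} (hX : IsStrictlyPositive X.1) : (σ one X).1 = cfc f X.1 := by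
  have hsa : IsSelfAdjoint X.1 := hX.isSelfAdjoint
  have hpos : ∀ x ∈ spectrum ℝ X.1, 0 < x := fun x hx => hX.spectrum_pos hx
  refine eq_cfc_of_tight_bounds hsa (σ one X).2.isSelfAdjoint (commute_coe hσ X)
    ((hf.continuousOn hσ).mono hpos) (fun x hx => ?_) (fun x hx => ?_)
  · have hx0 := hpos x hx
    have hc : Continuous fun t : ℝ => min 1 (t / x) := by fun_prop
    have hd : ∀ t ∈ spectrum ℝ X.1, 0 < min 1 (t / x) :=
      fun t ht => lt_min one_pos (div_pos (hpos t ht) hx0)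
    refine ⟨fun t => f x * min 1 (t / x), by fun_prop, ?_, by simp [hx0.ne']⟩
    -- `D ≤ I` and `xD ≤ X`, while `D σ xD = f(x) D`.
    let D : PosOp H := ⟨cfc (fun t : ℝ => min 1 (t / x)) X.1, cfc_nonneg fun t ht => (hd t ht).le⟩
    let E : PosOp H := ⟨x • D.1, smul_nonneg hx0.le D.2⟩
    have hD : IsUnit D.1 := (isUnit_cfc_iff _ X.1).2 fun t ht => (hd t ht).ne'
    have h := hσ.mono D E one X ?_ ?_
    · rw [cfc_const_mul (f x) _ X.1 (by fun_prop)]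
      exact (hσ.coe_eq_smul hf hD hx0.le (E := E) rfl).symm.le.trans h
    · exact cfc_le_one (fun t : ℝ => min 1 (t / x)) X.1 fun t ht => min_le_left 1 (t / x)
    · change x • cfc (fun t : ℝ => min 1 (t / x)) X.1 ≤ X.1
      rw [← cfc_const_mul x _ X.1 (by fun_prop)]
      conv_rhs => rw [← cfc_id' ℝ X.1]
      refine cfc_mono fun t ht => ?_
      calc x * min 1 (t / x) ≤ x * (t / x) := by gcongr; exact min_le_right _ _
        _ = t := by field_simp
  · have hx0 := hpos x hx
    have hc : Continuous fun t : ℝ => max 1 (t / x) := by fun_prop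
    have hd : ∀ t : ℝ, 0 < max 1 (t / x) := fun t => lt_max_of_lt_left one_pos
    refine ⟨fun t => f x * max 1 (t / x), by fun_prop, ?_, by simp [hx0.ne']⟩
    let D : PosOp H := ⟨cfc (fun t : ℝ => max 1 (t / x)) X.1, cfc_nonneg fun t _ => (hd t).le⟩
    let E : PosOp H := ⟨x • D.1, smul_nonneg hx0.le D.2⟩
    have hD : IsUnit D.1 := (isUnit_cfc_iff _ X.1).2 fun t _ => (hd t).ne'
    have h := hσ.mono one X D E ?_ ?_
    · rw [cfc_const_mul (f x) _ X.1 (by fun_prop)]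
      exact le_trans h (hσ.coe_eq_smul hf hD hx0.le (E := E) rfl).le
    · exact one_le_cfc (fun t : ℝ => max 1 (t / x)) X.1 fun t ht => le_max_left 1 (t / x)
    · change X.1 ≤ x • cfc (fun t : ℝ => max 1 (t / x)) X.1
      rw [← cfc_const_mul x _ X.1 (by fun_prop)]
      conv_lhs => rw [← cfc_id' ℝ X.1]
      refine cfc_mono fun t ht => ?_
      calc t = x * (t / x) := by field_simp
        _ ≤ x * max 1 (t / x) := by gcongr; exact le_max_right _ _

end IsRepresentingFunction

/-! ### The invariance equation. -/

section Invariance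

open PosOp

variable {H : Type*} [NormedAddCommGroup H] [InnerProductSpace ℂ H] [CompleteSpace H]
  [Nontrivial H] {σ τ ρ : PosOp H → PosOp H → PosOp H} {f g h : ℝ → ℝ}

/-- At `B = tI`, the `ρ`-value is the multiple `(g t)⁻¹ * h t` of the invertible `τ`-value. -/
theorem IsInvariantMean.representing_eq (hinv : IsInvariantMean σ τ ρ) (hσ : IsOperatorMean σ)
    (hf : IsRepresentingFunction σ f) (hg : IsRepresentingFunction τ g)
    (hh : IsRepresentingFunction ρ h) {t : ℝ} (ht : 0 ≤ t) (hgt : 0 < g t) :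
    f t = g t * f ((g t)⁻¹ * h t) := by
  have h1 := congrArg Subtype.val (hinv one (scalar t ht))
  have hT := hg t ht
  have hR := hh t ht
  have hD : IsUnit (τ one (scalar t ht)).1 := by
    rw [hT]
    exact (isStrictlyPositive_smul_one hgt).isUnit
  rw [hf t ht, hσ.coe_eq_smul hf (y := (g t)⁻¹ * h t) hD
    (mul_nonneg (inv_nonneg.2 hgt.le) (hh.nonneg ht))
    (by rw [hR, hT, smul_smul]; field_simp), hT, smul_smul, mul_comm] at h1
  exact le_antisymm (le_of_smul_one_le h1.le) (le_of_smul_one_le h1.ge)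

/-- The invariance identity for `A = I` and invertible `B`. -/
theorem apply_one_eq_of_representing_eq (hσ : IsOperatorMean σ) (hτ : IsOperatorMean τ)
    (hρ : IsOperatorMean ρ) (hf : IsRepresentingFunction σ f) (hg : IsRepresentingFunction τ g)
    (hh : IsRepresentingFunction ρ h)
    (hfgh : ∀ t, 0 < t → f t = g t * f ((g t)⁻¹ * h t))
    {Z : PosOp H} (hZ : IsStrictlyPositive Z.1) :
    σ one Z = σ (τ one Z) (ρ one Z) := by
  have hsa : IsSelfAdjoint Z.1 := hZ.isSelfAdjoint
  have hpos : spectrum ℝ Z.1 ⊆ Set.Ioi 0 := fun x hx => hZ.spectrum_pos hx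
  have hg0 : ∀ x ∈ spectrum ℝ Z.1, 0 < g x := fun x hx => hg.pos hτ (hpos hx)
  have hh0 : ∀ x ∈ spectrum ℝ Z.1, 0 < h x := fun x hx => hh.pos hρ (hpos hx)
  have hgc : ContinuousOn g (spectrum ℝ Z.1) := (hg.continuousOn hτ).mono hpos
  have hhc : ContinuousOn h (spectrum ℝ Z.1) := (hh.continuousOn hρ).mono hpos
  have hsc : ContinuousOn (fun t => √(g t)) (spectrum ℝ Z.1) := hgc.sqrt
  have hqc : ContinuousOn (fun t => (g t)⁻¹ * h t) (spectrum ℝ Z.1) :=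
    (hgc.inv₀ fun x hx => (hg0 x hx).ne').mul hhc
  have hq0 : ∀ x ∈ spectrum ℝ Z.1, 0 < (g x)⁻¹ * h x :=
    fun x hx => mul_pos (inv_pos.2 (hg0 x hx)) (hh0 x hx)
  have hqf : ContinuousOn f ((fun t => (g t)⁻¹ * h t) '' spectrum ℝ Z.1) := by
    refine (hf.continuousOn hσ).mono ?_
    rintro _ ⟨x, hx, rfl⟩
    exact hq0 x hx
  have hfqc : ContinuousOn (fun t => f ((g t)⁻¹ * h t)) (spectrum ℝ Z.1) :=
    hqf.comp hqc (Set.mapsTo_image _ _)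
  set S : H →L[ℂ] H := cfc (fun t => √(g t)) Z.1 with hS
  have hSsa : star S = S := (cfc_predicate (fun t => √(g t)) Z.1 : IsSelfAdjoint S).star_eq
  have hSu : IsUnit S :=
    (isUnit_cfc_iff _ Z.1 hsc).2 fun x hx => (Real.sqrt_pos.2 (hg0 x hx)).ne'
  let Q : PosOp H := ⟨cfc (fun t => (g t)⁻¹ * h t) Z.1, cfc_nonneg fun x hx => (hq0 x hx).le⟩
  have hQ : IsStrictlyPositive Q.1 :=
    IsUnit.isStrictlyPositive ((isUnit_cfc_iff _ Z.1 hqc).2 fun x hx => (hq0 x hx).ne') Q.2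
  have hconj : ∀ k : ℝ → ℝ, ContinuousOn k (spectrum ℝ Z.1) →
      star S * cfc k Z.1 * S = cfc (fun t => g t * k t) Z.1 := by
    intro k hk
    rw [hSsa, hS, ← cfc_mul _ _ Z.1 hsc hk, ← cfc_mul (fun x => √(g x) * k x) _ Z.1 (hsc.mul hk) hsc]
    refine cfc_congr fun x hx => ?_
    have := Real.mul_self_sqrt (hg0 x hx).le
    linear_combination k x * this
  have hT : τ one Z = conj S one := by
    refine Subtype.ext ?_
    have h1 := hconj (fun _ => 1) continuousOn_const
    rw [cfc_const_one ℝ Z.1] at h1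
    simp only [mul_one (g _)] at h1
    change _ = star S * 1 * S
    rw [hg.coe_eq_cfc hτ hZ, h1]
  have hR : ρ one Z = conj S Q := by
    refine Subtype.ext ?_
    change _ = star S * cfc _ Z.1 * S
    rw [hh.coe_eq_cfc hρ hZ, hconj _ hqc]
    refine cfc_congr fun x hx => ?_
    have := (hg0 x hx).ne'
    field_simp
  rw [hT, hR, ← hσ.conj_eq hSu]
  refine Subtype.ext ?_
  change _ = star S * (σ one Q).1 * S
  rw [hf.coe_eq_cfc hσ hZ, hf.coe_eq_cfc hσ hQ, ← cfc_comp' f _ Z.1 hqf hqc, hconj _ hfqc]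
  exact cfc_congr fun x hx => hfgh x (hpos hx)

/-- Only `t > 0` matters: perturbed operators are invertible, and the limit does the rest. -/
theorem isInvariantMean_of_representing_eq (hσ : IsOperatorMean σ) (hτ : IsOperatorMean τ)
    (hρ : IsOperatorMean ρ) (hf : IsRepresentingFunction σ f) (hg : IsRepresentingFunction τ g)
    (hh : IsRepresentingFunction ρ h)
    (hfgh : ∀ t, 0 < t → f t = g t * f ((g t)⁻¹ * h t)) :
    IsInvariantMean σ τ ρ := by
  have hinv : ∀ A B : PosOp H, IsStrictlyPositive A.1 → IsStrictlyPositive B.1 →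
      σ A B = σ (τ A B) (ρ A B) := by
    intro A B hA hB
    obtain ⟨S, hS, rfl⟩ := exists_conj_one_eq A hA.isUnit
    obtain ⟨u, rfl⟩ := hS
    obtain ⟨Z, rfl⟩ : ∃ Z, B = conj (u : H →L[ℂ] H) Z :=
      ⟨conj (↑u⁻¹ : H →L[ℂ] H) B, by simp only [conj_conj, Units.inv_mul, conj_one_left]⟩
    have hZ : IsStrictlyPositive Z.1 := u.isUnit.isStrictlyPositive_star_left_conjugate_iff.1 hB
    rw [← hσ.conj_eq u.isUnit, ← hτ.conj_eq u.isUnit, ← hρ.conj_eq u.isUnit,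
      ← hσ.conj_eq u.isUnit, apply_one_eq_of_representing_eq hσ hτ hρ hf hg hh hfgh hZ]
  intro A B
  have hA := decreasesTo_addInv A
  have hB := decreasesTo_addInv B
  have hlim := hσ.continuous_above _ _ _ _ (hτ.continuous_above _ _ _ _ hA hB)
    (hρ.continuous_above _ _ _ _ hA hB)
  have heq : (fun n => σ (τ (addInv A n) (addInv B n)) (ρ (addInv A n) (addInv B n))) =
      fun n => σ (addInv A n) (addInv B n) :=
    funext fun n => (hinv _ _ (isStrictlyPositive_addInv A n) (isStrictlyPositive_addInv B n)).symm
  rw [heq] at hlim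
  exact (hσ.continuous_above _ _ _ _ hA hB).limit_unique hlim

end Invariance

theorem mainTheorem7 {H : Type*} [NormedAddCommGroup H] [InnerProductSpace ℂ H]
    [CompleteSpace H] [Nontrivial H]
    (σ τ ρ : PosOp H → PosOp H → PosOp H)
    (hσ : IsOperatorMean σ) (hτ : IsOperatorMean τ) (hρ : IsOperatorMean ρ)
    (f g h : ℝ → ℝ)
    (hf : IsRepresentingFunction σ f) (hg : IsRepresentingFunction τ g)
    (hh : IsRepresentingFunction ρ h) :
    (∀ t : ℝ, 0 < t → 0 < g t) ∧
    (IsInvariantMean σ τ ρ ↔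
      ∀ t : ℝ, 0 ≤ t →
        (g t ≠ 0 → f t = g t * f ((g t)⁻¹ * h t)) ∧
        (g t = 0 →
          Tendsto (fun s => g s * f ((g s)⁻¹ * h s)) (𝓝[>] t) (𝓝 (f t)))) := by
  have hgpos : ∀ t : ℝ, 0 < t → 0 < g t := fun t ht => hg.pos hτ ht
  refine ⟨hgpos, fun hinv t ht => ⟨fun hgt => ?_, fun hgt => ?_⟩, fun heq => ?_⟩
  · exact hinv.representing_eq hσ hf hg hh ht (lt_of_le_of_ne (hg.nonneg ht) hgt.symm)
  · obtain rfl : t = 0 := by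
      by_contra hne
      exact (hgpos t (lt_of_le_of_ne ht (Ne.symm hne))).ne' hgt
    refine (hf.tendsto_zero hσ).congr' ?_
    filter_upwards [self_mem_nhdsWithin] with s hs
    exact hinv.representing_eq hσ hf hg hh (le_of_lt hs) (hgpos s hs)
  · exact isInvariantMean_of_representing_eq hσ hτ hρ hf hg hh
      fun t ht => (heq t ht.le).1 (hgpos t ht).ne'
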